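/- Let $X\in\mathbb R^{n\times p}$ be fixed, $\lambda>0$, and $y\sim N(\mu,\sigma^2 I_n)$ with $\mu\in\mathbb R^n$, $\sigma>0$. Assume that for every $y\in\mathbb R^n$ the lasso problem has a unique solution $$\hat\beta=\hat\beta(y)=\arg\min_{\beta\in\mathbb R^p}\ \|y-X\beta\|_2^2+\lambda\|\beta\|_1 .$$ For a fitting function $\hat\mu:\mathbb R^n\to\mathbb R^n$ put $\mathrm{df}(\hat\mu)=\sigma^{-2}\sum_{i=1}^n\mathrm{Cov}(\hat\mu_i(y),y_i)$, and if the fit is written $\hat\mu(y)=S(y)y$ put $\mathrm{msdf}(\hat\mu)=\mathrm{df}(\hat\mu)-\mathbb E[\operatorname{tr}S(y)]$ (the modified search degrees of freedom). Let $\Psi(y)=\mathrm{diag}\{1/(2|\hat\beta_1|),\dots,1/(2|\hat\beta_p|)\}$ and $S(y)=X(X^\top X+\lambda\Psi(y))^{-1}X^\top$. Here a coefficient $\hat\beta_j=0$ carries the penalty $+\infty$: with $A=\{j:\hat\beta_j\ne0\}$, the matrix $(X^\top X+\lambda\Psi(y))^{-1}$ has $A\times A$ block $(X_A^\top X_A+\lambda\Psi_A(y))^{-1}$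 and all other entries $0$. Then: 1. For every $b\in\mathbb R^p$, the matrix so defined with $b$ in place of $\hat\beta$ is the limit of $(X^\top X+\lambda\,\mathrm{diag}\{1/(2|\theta_j|)\})^{-1}$ as $\theta\to b$ with all $\theta_j\neq0$. 2. For every $y$, $\hat\beta=(X^\top X+\lambda\Psi(y))^{-1}X^\top y$ and $\hat y=X\hat\beta=S(y)y$. 3. $\hat\beta$ is differentiable at Lebesgue-almost every $y$. At every $y$ where $\hat\beta$ is differentiable, $S$ is differentiable, and for $i=1,\dots,n$ $$\frac{\partial S(y)}{\partial y_i}=-\lambda X(X^\top X+\lambda\Psi(y))^{-1}\,C_{\hat\beta}\,D_{\hat\beta}\,(X^\top X+\lambda\Psi(y))^{-1}X^\top,$$ $$C_{\hat\beta}=\mathrm{diag}\Big\{\frac{-\mathrm{sign}(\hat\beta_1)}{2\hat\beta_1^2},\dots,\frac{-\mathrm{sign}(\hat\beta_p)}{2\hat\beta_p^2}\Big\},\qquad D_{\hat\beta}=\mathrm{diag}\Big\{\frac{\partial\hat\beta_1}{\partial y_i},\dots,\frac{\partial\hat\beta_p}{\partial y_i}\Big\},$$ where $\mathrm{sign}(0)=0$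 and $0/0$ is read as $0$. 4. With $$\delta(y)=\sum_{i=1}^n\sum_{j=1}^n\frac{\partial S_{ij}(y)}{\partial y_i}\,y_j ,$$ which is defined for almost every $y$, each $\hat y_i$ is square integrable, $\delta(y)$ and $\operatorname{tr}S(y)$ are integrable, the degrees of freedom of the lasso fit $\hat y$ is $$\mathrm{df}=\mathbb E[\delta(y)+\operatorname{tr}S(y)],$$ and hence its modified search degrees of freedom with respect to $S$ is $$\mathrm{msdf}=\mathbb E[\delta(y)] .$$ -/

import Mathlib

open MeasureTheory ProbabilityTheory Filter Topology
open scoped NNReal ENNReal Matrix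

noncomputable section

/-- The partial derivative `∂f/∂y_i` at the point `z`. -/
def pderiv {n : ℕ} (i : Fin n) (f : (Fin n → ℝ) → ℝ) (z : Fin n → ℝ) : ℝ :=
  lineDeriv ℝ f z (Pi.single i 1)

/-- `df(μ̂) = σ⁻² ∑ᵢ Cov(μ̂ᵢ(y), yᵢ)` for a random vector `y` and a fitting function `μ̂`. -/
def degreesOfFreedom {Ω : Type*} [MeasurableSpace Ω] {n : ℕ} (P : Measure Ω)
    (y : Ω → Fin n → ℝ) (σ : ℝ≥0) (muhat : (Fin n → ℝ) → Fin n → ℝ) : ℝ :=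
  (1 / (σ : ℝ) ^ 2) * ∑ i, cov[fun ω => muhat (y ω) i, fun ω => y ω i; P]

/-- `msdf(μ̂) = df(μ̂) - E[tr S(y)]`, for a fit written in the form `μ̂(y) = S(y) y`. -/
def modifiedSearchDF {Ω : Type*} [MeasurableSpace Ω] {n : ℕ} (P : Measure Ω)
    (y : Ω → Fin n → ℝ) (σ : ℝ≥0) (S : (Fin n → ℝ) → Matrix (Fin n) (Fin n) ℝ) : ℝ :=
  degreesOfFreedom P y σ (fun z => S z *ᵥ z) - ∫ ω, (S (y ω)).trace ∂P

/-- The lasso criterion `‖y - Xβ‖₂² + λ‖β‖₁`. -/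
def lassoObjective {n p : ℕ} (X : Matrix (Fin n) (Fin p) ℝ) (lam : ℝ) (y : Fin n → ℝ)
    (b : Fin p → ℝ) : ℝ :=
  ∑ i, (y i - (X *ᵥ b) i) ^ 2 + lam * ∑ j, |b j|

/-- `b` minimizes the lasso criterion at the data `y`. -/
def IsLassoSolution {n p : ℕ} (X : Matrix (Fin n) (Fin p) ℝ) (lam : ℝ) (y : Fin n → ℝ)
    (b : Fin p → ℝ) : Prop :=
  ∀ b' : Fin p → ℝ, lassoObjective X lam y b ≤ lassoObjective X lam y b'

/-- `X_Aᵀ X_A + λ Ψ_A` for the support `A = {j | β_j ≠ 0}` of `β`, where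
`Ψ_A = diag(1 / (2|β_j|))_{j ∈ A}`. -/
def activeRidgeMatrix {n p : ℕ} (X : Matrix (Fin n) (Fin p) ℝ) (lam : ℝ) (b : Fin p → ℝ) :
    Matrix {j : Fin p // b j ≠ 0} {j : Fin p // b j ≠ 0} ℝ :=
  (X.submatrix id Subtype.val)ᵀ * X.submatrix id Subtype.val
    + lam • Matrix.diagonal fun j => 1 / (2 * |b j.1|)

/-- `(XᵀX + λΨ)⁻¹` with `Ψ = diag(1 / (2|β_j|))`. A coefficient `β_j = 0` carries the penalty `+∞`,
which makes the `j`-th row and column of the inverse zero; the block over the support of `β` is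
the inverse of `X_Aᵀ X_A + λ Ψ_A`. -/
def ridgeInv {n p : ℕ} (X : Matrix (Fin n) (Fin p) ℝ) (lam : ℝ) (b : Fin p → ℝ) :
    Matrix (Fin p) (Fin p) ℝ :=
  Matrix.of fun j k =>
    if h : b j ≠ 0 ∧ b k ≠ 0 then (activeRidgeMatrix X lam b)⁻¹ ⟨j, h.1⟩ ⟨k, h.2⟩ else 0

/-- `S(y) = X (XᵀX + λΨ(y))⁻¹ Xᵀ`, with `Ψ(y)` built from the coefficients `β̂(y)`. -/
def lassoSmoother {n p : ℕ} (X : Matrix (Fin n) (Fin p) ℝ) (lam : ℝ)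
    (betahat : (Fin n → ℝ) → Fin p → ℝ) (z : Fin n → ℝ) : Matrix (Fin n) (Fin n) ℝ :=
  X * ridgeInv X lam (betahat z) * Xᵀ

/-- `δ = ∑ᵢ ∑ⱼ (∂S_ij/∂y_i) y_j`. -/
def searchCorrection {n : ℕ} (S : (Fin n → ℝ) → Matrix (Fin n) (Fin n) ℝ) (z : Fin n → ℝ) : ℝ :=
  ∑ i, ∑ j, pderiv i (fun w => S w i j) z * z j

/-- `C = diag(-sign(β_j) / (2 β_j²))`; the entry is `0` (`0/0` read as `0`) when `β_j = 0`. -/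
def signMatrix {p : ℕ} (b : Fin p → ℝ) : Matrix (Fin p) (Fin p) ℝ :=
  Matrix.diagonal fun j => -Real.sign (b j) / (2 * b j ^ 2)

/-- `D = diag(∂β̂_j/∂y_i)`. -/
def coefDerivMatrix {n p : ℕ} (betahat : (Fin n → ℝ) → Fin p → ℝ) (i : Fin n) (z : Fin n → ℝ) :
    Matrix (Fin p) (Fin p) ℝ :=
  Matrix.diagonal fun j => pderiv i (fun w => betahat w j) z

end

/-! With `D = diag|b|` and `K = XᵀX D + (λ/2) I`, the generalized inverse factors as `R = D K⁻¹`.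
The matrix `K` is invertible for every `b`, zeros included, so nothing is divided by a coefficient:
the limit in part 1 becomes continuity of `D K⁻¹` (`ridgeInv_eq`, `continuous_ridgeInv`). Part 2 is
the lasso optimality condition: the residual correlations divided by `λ/2` form a vector `s` with `D
s = b` and `K s = Xᵀ z`, whence `R Xᵀ z = R K s = D s = b`.

Monotonicity of the subgradient makes the fit Lipschitz, and uniqueness makes the active columns
independent, so `β̂` itself is Lipschitz and Rademacher's theorem gives a.e. differentiability. A
coefficient never takes both signs near a point, so `|β̂_j|` is differentiable wherever `β̂` is;
differentiating `R K = D` then yields the formula for `∂S`.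

For part 4, Stein's identity, proved for Lipschitz functions, turns `Cov(ŷ_i, y_i)` into `σ²
E[∂ŷ_i/∂y_i]`. The product rule applied to `ŷ = S(y) y` splits the divergence into `δ + tr S`. The
divergence is bounded since the fit is Lipschitz, and the trace is bounded since `|S_ii| ≤ 1`, so
`δ` is integrable as their difference. -/

/-! ### The generalized ridge inverse and its division-free factorization -/

section RidgeInverse

variable {n p : ℕ}

/-- `XᵀX diag|b| + (λ/2) I`, through which `(XᵀX + λΨ)⁻¹` factors as `diag|b|` times its inverse. -/
noncomputable def ridgeCore (X : Matrix (Fin n) (Fin p) ℝ) (lam : ℝ) (b : Fin p → ℝ) :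
    Matrix (Fin p) (Fin p) ℝ :=
  Xᵀ * X * Matrix.diagonal (fun j => |b j|) + (lam / 2) • 1

/-- Pairing with `D q` instead of `q` symmetrizes the form and leaves two nonnegative terms. Both
the invertibility of `K` and the bound on the diagonal of `S` come from this. -/
lemma dotProduct_ridgeCore_mulVec (X : Matrix (Fin n) (Fin p) ℝ) (lam : ℝ) (b q : Fin p → ℝ) :
    (fun j => |b j| * q j) ⬝ᵥ (ridgeCore X lam b *ᵥ q) =
      (X *ᵥ fun j => |b j| * q j) ⬝ᵥ (X *ᵥ fun j => |b j| * q j)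
        + lam / 2 * ∑ j, |b j| * q j ^ 2 := by
  have h : ridgeCore X lam b *ᵥ q
      = Xᵀ *ᵥ (X *ᵥ fun j => |b j| * q j) + (lam / 2) • q := by
    have hd : Matrix.diagonal (fun j => |b j|) *ᵥ q = fun j => |b j| * q j := by
      ext j; rw [Matrix.mulVec_diagonal]
    rw [ridgeCore, Matrix.add_mulVec, ← Matrix.mulVec_mulVec, hd, ← Matrix.mulVec_mulVec,
      Matrix.smul_mulVec, Matrix.one_mulVec]
  rw [h, dotProduct_add, Matrix.dotProduct_mulVec, Matrix.vecMul_transpose]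
  congr 1
  simp only [dotProduct, Finset.mul_sum, Pi.smul_apply, smul_eq_mul]
  exact Finset.sum_congr rfl fun j _ => by ring

lemma isUnit_ridgeCore (X : Matrix (Fin n) (Fin p) ℝ) {lam : ℝ} (hlam : 0 < lam)
    (b : Fin p → ℝ) : IsUnit (ridgeCore X lam b) := by
  rw [← Matrix.mulVec_injective_iff_isUnit, ← Matrix.coe_mulVecLin, injective_iff_map_eq_zero]
  intro q hq
  rw [Matrix.mulVecLin_apply] at hq
  have h := dotProduct_ridgeCore_mulVec X lam b q
  rw [hq, dotProduct_zero] at h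
  have h1 : 0 ≤ (X *ᵥ fun j => |b j| * q j) ⬝ᵥ (X *ᵥ fun j => |b j| * q j) :=
    Finset.sum_nonneg fun i _ => mul_self_nonneg _
  have hnn : ∀ j ∈ Finset.univ, 0 ≤ |b j| * q j ^ 2 := fun j _ => by positivity
  have h2 : ∑ j, |b j| * q j ^ 2 = 0 := by
    have := Finset.sum_nonneg hnn
    nlinarith
  rw [Finset.sum_eq_zero_iff_of_nonneg hnn] at h2
  have h3 : Matrix.diagonal (fun j => |b j|) *ᵥ q = 0 := by
    ext j
    have := h2 j (Finset.mem_univ j)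
    rw [Matrix.mulVec_diagonal]
    rcases mul_eq_zero.1 this with h | h
    · simp [h]
    · simp [pow_eq_zero_iff] at h; simp [h]
  rw [ridgeCore, Matrix.add_mulVec, ← Matrix.mulVec_mulVec, h3, Matrix.mulVec_zero, zero_add,
    Matrix.smul_mulVec, Matrix.one_mulVec] at hq
  exact (smul_eq_zero.1 hq).resolve_left (by positivity)

lemma isUnit_activeRidgeMatrix (X : Matrix (Fin n) (Fin p) ℝ) {lam : ℝ} (hlam : 0 < lam)
    (b : Fin p → ℝ) : IsUnit (activeRidgeMatrix X lam b) := by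
  apply Matrix.PosDef.isUnit
  refine Matrix.PosDef.posSemidef_add ?_ ?_
  · simpa using Matrix.posSemidef_conjTranspose_mul_self
      (X.submatrix id (Subtype.val : {j : Fin p // b j ≠ 0} → Fin p))
  · refine Matrix.PosDef.smul (Matrix.PosDef.diagonal fun j => ?_) hlam
    have := abs_pos.2 j.2
    positivity

/-- On the support, `K` is the active matrix `M` with its columns scaled by `|b_k|`, so the block of
the product is `M⁻¹ M D`. For `b_k = 0` column `k` of `K` is `(λ/2) e_k`, which the zero column of
`ridgeInv` annihilates. -/
lemma ridgeInv_mul_ridgeCore (X : Matrix (Fin n) (Fin p) ℝ) {lam : ℝ} (hlam : 0 < lam)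
    (b : Fin p → ℝ) :
    ridgeInv X lam b * ridgeCore X lam b = Matrix.diagonal fun j => |b j| := by
  classical
  ext j k
  by_cases hj : b j = 0
  · have hz : ∀ l, ridgeInv X lam b j l = 0 := fun l => by simp [ridgeInv, hj]
    rw [Matrix.mul_apply]
    simp only [hz, zero_mul, Finset.sum_const_zero]
    by_cases hjk : j = k
    · subst hjk; simp [hj]
    · simp [hjk]
  by_cases hk : b k = 0
  · have hz : ridgeInv X lam b j k = 0 := by simp [ridgeInv, hk]
    have hjk : j ≠ k := fun h => hj (h ▸ hk)
    rw [ridgeCore, mul_add, Matrix.add_apply, ← mul_assoc, Matrix.mul_diagonal, Matrix.mul_smul,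
      mul_one, Matrix.smul_apply, hz]
    simp [hk, hjk]
  set M := activeRidgeMatrix X lam b with hM
  have hcore : ∀ l : {j : Fin p // b j ≠ 0},
      ridgeCore X lam b l k = M l ⟨k, hk⟩ * |b k| := by
    intro l
    have hb : |b k| ≠ 0 := abs_ne_zero.2 hk
    rw [hM, activeRidgeMatrix, ridgeCore, Matrix.add_apply, Matrix.add_apply, Matrix.mul_diagonal,
      Matrix.mul_apply, Matrix.mul_apply, Matrix.smul_apply, Matrix.smul_apply, add_mul]
    congr 1
    by_cases hl : l = ⟨k, hk⟩
    · subst hl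
      simp
      field_simp
    · have hl' : (l : Fin p) ≠ k := fun h => hl (Subtype.ext h)
      simp [hl, hl']
  have hinv : M⁻¹ * M = 1 :=
    Matrix.nonsing_inv_mul _ ((Matrix.isUnit_iff_isUnit_det _).1 (isUnit_activeRidgeMatrix X hlam b))
  have hsum : (ridgeInv X lam b * ridgeCore X lam b) j k
      = ∑ l : {j : Fin p // b j ≠ 0}, M⁻¹ ⟨j, hj⟩ l * (M l ⟨k, hk⟩ * |b k|) := by
    rw [Matrix.mul_apply]
    refine (Fintype.sum_of_injective Subtype.val Subtype.val_injective _ _ (fun l hl => ?_)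
      fun l => ?_).symm
    · have hl' : b l = 0 := by
        by_contra h
        exact hl ⟨⟨l, h⟩, rfl⟩
      simp [ridgeInv, hl']
    · rw [hcore l]
      congr 1
      simp only [ridgeInv, Matrix.of_apply]
      rw [dif_pos ⟨hj, l.2⟩]
  rw [hsum]
  simp only [← mul_assoc]
  rw [← Finset.sum_mul, ← Matrix.mul_apply, hinv]
  by_cases hjk : j = k
  · subst hjk; simp
  · simp [hjk]

lemma ridgeInv_eq (X : Matrix (Fin n) (Fin p) ℝ) {lam : ℝ} (hlam : 0 < lam) (b : Fin p → ℝ) :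
    ridgeInv X lam b = Matrix.diagonal (fun j => |b j|) * (ridgeCore X lam b)⁻¹ := by
  rw [← ridgeInv_mul_ridgeCore X hlam b, mul_assoc, Matrix.mul_nonsing_inv, mul_one]
  exact (Matrix.isUnit_iff_isUnit_det _).1 (isUnit_ridgeCore X hlam b)

lemma inv_ridge_eq (X : Matrix (Fin n) (Fin p) ℝ) {lam : ℝ} (hlam : 0 < lam) {b : Fin p → ℝ}
    (hb : ∀ j, b j ≠ 0) :
    (Xᵀ * X + lam • Matrix.diagonal fun j => 1 / (2 * |b j|))⁻¹ = ridgeInv X lam b := by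
  rw [ridgeInv_eq X hlam]
  apply Matrix.inv_eq_right_inv
  rw [← mul_assoc, add_mul, Matrix.smul_mul, Matrix.diagonal_mul_diagonal]
  have h : (fun j => 1 / (2 * |b j|) * |b j|) = fun _ => (1 / 2 : ℝ) := by
    ext j
    have := abs_ne_zero.2 (hb j)
    field_simp
  have h2 : lam • Matrix.diagonal (fun _ : Fin p => (1 / 2 : ℝ)) = (lam / 2) • 1 := by
    rw [← Matrix.smul_one_eq_diagonal, smul_smul]; congr 1; ring
  rw [h, h2]
  exact Matrix.mul_nonsing_inv _ ((Matrix.isUnit_iff_isUnit_det _).1 (isUnit_ridgeCore X hlam b))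

lemma continuous_ridgeInv (X : Matrix (Fin n) (Fin p) ℝ) {lam : ℝ} (hlam : 0 < lam) :
    Continuous (ridgeInv X lam) := by
  have h : ridgeInv X lam = fun b =>
      Matrix.diagonal (fun j => |b j|) * (ridgeCore X lam b)⁻¹ := funext (ridgeInv_eq X hlam)
  rw [h]
  have hd : Continuous fun b : Fin p → ℝ => Matrix.diagonal (fun j => |b j|) :=
    Continuous.matrix_diagonal (by fun_prop)
  have hc : Continuous (ridgeCore X lam) := by
    unfold ridgeCore
    exact (continuous_const.matrix_mul hd).add continuous_const
  refine hd.matrix_mul ?_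
  rw [continuous_iff_continuousAt]
  intro b
  simp only [Matrix.inv_def, ContinuousAt]
  refine Tendsto.smul ?_ hc.matrix_adjugate.continuousAt
  simp only [Ring.inverse_eq_inv']
  refine (hc.matrix_det.continuousAt).inv₀ ?_
  exact ((Matrix.isUnit_iff_isUnit_det _).1 (isUnit_ridgeCore X hlam b)).ne_zero

lemma transpose_ridgeInv (X : Matrix (Fin n) (Fin p) ℝ) (lam : ℝ) (b : Fin p → ℝ) :
    (ridgeInv X lam b)ᵀ = ridgeInv X lam b := by
  have hM : (activeRidgeMatrix X lam b)ᵀ = activeRidgeMatrix X lam b := by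
    simp [activeRidgeMatrix, Matrix.transpose_mul, Matrix.diagonal_transpose]
  ext j k
  rw [Matrix.transpose_apply]
  by_cases h : b j ≠ 0 ∧ b k ≠ 0
  · simp only [ridgeInv, Matrix.of_apply, dif_pos h, dif_pos h.symm]
    rw [← Matrix.transpose_apply (activeRidgeMatrix X lam b)⁻¹, Matrix.transpose_nonsing_inv, hM]
  · have h' : ¬ (b k ≠ 0 ∧ b j ≠ 0) := fun h' => h h'.symm
    simp only [ridgeInv, Matrix.of_apply, dif_neg h, dif_neg h']

lemma tendsto_inv_ridge (X : Matrix (Fin n) (Fin p) ℝ) {lam : ℝ} (hlam : 0 < lam)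
    (b : Fin p → ℝ) :
    Tendsto (fun θ : Fin p → ℝ => (Xᵀ * X + lam • Matrix.diagonal fun j => 1 / (2 * |θ j|))⁻¹)
      (𝓝[{θ : Fin p → ℝ | ∀ j, θ j ≠ 0}] b) (𝓝 (ridgeInv X lam b)) := by
  refine Tendsto.congr' ?_ ((continuous_ridgeInv X hlam).continuousAt.mono_left
    nhdsWithin_le_nhds)
  filter_upwards [self_mem_nhdsWithin] with θ hθ
  exact (inv_ridge_eq X hlam hθ).symm

/-- For `w = S e_i` the quadratic identity reads `w_i = w ⬝ w + (nonnegative)`, so `w_i ≥ w_i²`. -/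
lemma abs_diag_smoother_le_one (X : Matrix (Fin n) (Fin p) ℝ) {lam : ℝ} (hlam : 0 < lam)
    (b : Fin p → ℝ) (i : Fin n) : |(X * ridgeInv X lam b * Xᵀ) i i| ≤ 1 := by
  set u : Fin n → ℝ := Pi.single i 1
  set q := (ridgeCore X lam b)⁻¹ *ᵥ (Xᵀ *ᵥ u) with hq
  have hKq : ridgeCore X lam b *ᵥ q = Xᵀ *ᵥ u := by
    rw [hq, Matrix.mulVec_mulVec, Matrix.mul_nonsing_inv, Matrix.one_mulVec]
    exact (Matrix.isUnit_iff_isUnit_det _).1 (isUnit_ridgeCore X hlam b)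
  have hw : (X * ridgeInv X lam b * Xᵀ) *ᵥ u = X *ᵥ fun j => |b j| * q j := by
    rw [ridgeInv_eq X hlam, ← Matrix.mulVec_mulVec, ← Matrix.mulVec_mulVec, ← Matrix.mulVec_mulVec,
      ← hq]
    congr 1
    ext j; rw [Matrix.mulVec_diagonal]
  have h := dotProduct_ridgeCore_mulVec X lam b q
  rw [hKq, Matrix.dotProduct_mulVec, Matrix.vecMul_transpose, ← hw] at h
  set w := (X * ridgeInv X lam b * Xᵀ) *ᵥ u with hwdef
  have hwi : w i = (X * ridgeInv X lam b * Xᵀ) i i := by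
    simp [hwdef, u, Matrix.mulVec_single]
  have hnn : 0 ≤ lam / 2 * ∑ j, |b j| * q j ^ 2 := by positivity
  have h1 : w ⬝ᵥ u = w i := by simp [u]
  have h2 : w i * w i ≤ w ⬝ᵥ w :=
    Finset.single_le_sum (f := fun k => w k * w k) (fun k _ => mul_self_nonneg _)
      (Finset.mem_univ i)
  rw [← hwi, abs_le]
  constructor <;> nlinarith

end RidgeInverse

/-! ### Optimality conditions for the lasso and their consequences -/

section Optimality

variable {n p : ℕ}

/-- The correlations `Xᵀ(z - Xb)` of the columns of `X` with the residual. -/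
noncomputable def residualCorr (X : Matrix (Fin n) (Fin p) ℝ) (z : Fin n → ℝ) (b : Fin p → ℝ) :
    Fin p → ℝ :=
  Xᵀ *ᵥ (z - X *ᵥ b)

lemma residualCorr_dotProduct (X : Matrix (Fin n) (Fin p) ℝ) (z : Fin n → ℝ) (b v : Fin p → ℝ) :
    residualCorr X z b ⬝ᵥ v = (z - X *ᵥ b) ⬝ᵥ (X *ᵥ v) := by
  rw [residualCorr, dotProduct_comm, Matrix.dotProduct_mulVec, Matrix.vecMul_transpose,
    dotProduct_comm]

lemma lassoObjective_add (X : Matrix (Fin n) (Fin p) ℝ) (lam : ℝ) (z : Fin n → ℝ)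
    (b v : Fin p → ℝ) :
    lassoObjective X lam z (b + v) = lassoObjective X lam z b - 2 * (residualCorr X z b ⬝ᵥ v)
      + (X *ᵥ v) ⬝ᵥ (X *ᵥ v) + lam * (∑ j, |b j + v j| - ∑ j, |b j|) := by
  have h : ∑ i, (z i - (X *ᵥ (b + v)) i) ^ 2 = ∑ i, (z i - (X *ᵥ b) i) ^ 2
      - 2 * ((z - X *ᵥ b) ⬝ᵥ (X *ᵥ v)) + (X *ᵥ v) ⬝ᵥ (X *ᵥ v) := by
    simp only [dotProduct, Finset.mul_sum, ← Finset.sum_sub_distrib, ← Finset.sum_add_distrib,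
      Matrix.mulVec_add, Pi.add_apply, Pi.sub_apply]
    exact Finset.sum_congr rfl fun i _ => by ring
  rw [lassoObjective, lassoObjective, h, residualCorr_dotProduct]
  simp only [Pi.add_apply]
  ring

/-- Divide by `s` and let `s ↓ 0`: the first-order test that replaces subgradient calculus below. -/
lemma nonneg_of_forall_mul_add_sq_nonneg {a g : ℝ}
    (h : ∀ s : ℝ, 0 < s → s ≤ 1 → 0 ≤ s * a + s ^ 2 * g) : 0 ≤ a := by
  have ht : Tendsto (fun s : ℝ => a + s * g) (𝓝[>] 0) (𝓝 a) := by
    have : Continuous fun s : ℝ => a + s * g := by fun_prop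
    simpa using (this.tendsto 0).mono_left nhdsWithin_le_nhds
  refine ge_of_tendsto ht ?_
  filter_upwards [Ioc_mem_nhdsGT (zero_lt_one' ℝ)] with s hs
  have := h s hs.1 hs.2
  exact nonneg_of_mul_nonneg_right (by linarith : 0 ≤ s * (a + s * g)) hs.1

lemma IsLassoSolution.coordinate {X : Matrix (Fin n) (Fin p) ℝ} {lam : ℝ} {z : Fin n → ℝ}
    {b : Fin p → ℝ} (h : IsLassoSolution X lam z b) (j : Fin p) (t : ℝ) :
    0 ≤ -2 * residualCorr X z b j * t + t ^ 2 * ((X.col j) ⬝ᵥ (X.col j))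
      + lam * (|b j + t| - |b j|) := by
  have h1 := h (b + Pi.single j t)
  rw [lassoObjective_add] at h1
  have h2 : ∑ k, |b k + (Pi.single j t : Fin p → ℝ) k| - ∑ k, |b k| = |b j + t| - |b j| := by
    rw [← Finset.sum_sub_distrib, Finset.sum_eq_single j]
    · simp
    · intro k _ hk; simp [hk]
    · simp
  have h3 : (X *ᵥ Pi.single j t) ⬝ᵥ (X *ᵥ Pi.single j t) = t ^ 2 * ((X.col j) ⬝ᵥ (X.col j)) := by
    simp only [dotProduct, Matrix.mulVec_single, Finset.mul_sum]
    exact Finset.sum_congr rfl fun i _ => by simp; ring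
  rw [h2, h3, dotProduct_single] at h1
  linarith

lemma IsLassoSolution.abs_residualCorr_le {X : Matrix (Fin n) (Fin p) ℝ} {lam : ℝ}
    (hlam : 0 < lam) {z : Fin n → ℝ} {b : Fin p → ℝ} (h : IsLassoSolution X lam z b) (j : Fin p) :
    |residualCorr X z b j| ≤ lam / 2 := by
  have key : ∀ e : ℝ, |e| = 1 → 0 ≤ -2 * residualCorr X z b j * e + lam := by
    intro e he
    apply nonneg_of_forall_mul_add_sq_nonneg (g := e ^ 2 * ((X.col j) ⬝ᵥ (X.col j)))
    intro s hs _
    have h1 := h.coordinate j (s * e)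
    have h2 : |b j + s * e| - |b j| ≤ s := by
      have := abs_add_le (b j) (s * e)
      rw [abs_mul, he, abs_of_pos hs] at this
      linarith
    have h3 := mul_le_mul_of_nonneg_left h2 hlam.le
    nlinarith
  have h1 := key 1 (by simp)
  have h2 := key (-1) (by simp)
  rw [abs_le]
  constructor <;> linarith

lemma IsLassoSolution.residualCorr_mul {X : Matrix (Fin n) (Fin p) ℝ} {lam : ℝ}
    (hlam : 0 < lam) {z : Fin n → ℝ} {b : Fin p → ℝ} (h : IsLassoSolution X lam z b) (j : Fin p) :
    residualCorr X z b j * b j = lam / 2 * |b j| := by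
  apply le_antisymm
  · calc residualCorr X z b j * b j ≤ |residualCorr X z b j * b j| := le_abs_self _
      _ = |residualCorr X z b j| * |b j| := abs_mul _ _
      _ ≤ lam / 2 * |b j| :=
        mul_le_mul_of_nonneg_right (h.abs_residualCorr_le hlam j) (abs_nonneg _)
  · have : 0 ≤ 2 * residualCorr X z b j * b j - lam * |b j| := by
      apply nonneg_of_forall_mul_add_sq_nonneg (g := b j ^ 2 * ((X.col j) ⬝ᵥ (X.col j)))
      intro s hs hs1
      -- Shrinking `b_j` by the factor `1 - s` changes its penalty exactly linearly in `s`.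
      have h1 := h.coordinate j (-(s * b j))
      have h2 : |b j + -(s * b j)| = (1 - s) * |b j| := by
        rw [show b j + -(s * b j) = (1 - s) * b j by ring, abs_mul, abs_of_nonneg (by linarith)]
      rw [h2] at h1
      nlinarith
    linarith

lemma IsLassoSolution.eq_ridgeInv_mulVec {X : Matrix (Fin n) (Fin p) ℝ} {lam : ℝ}
    (hlam : 0 < lam) {z : Fin n → ℝ} {b : Fin p → ℝ} (h : IsLassoSolution X lam z b) :
    b = (ridgeInv X lam b * Xᵀ) *ᵥ z := by
  set s : Fin p → ℝ := fun j => residualCorr X z b j / (lam / 2) with hs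
  have hDs : Matrix.diagonal (fun j => |b j|) *ᵥ s = b := by
    ext j
    rw [Matrix.mulVec_diagonal, hs]
    have h1 := h.residualCorr_mul hlam j
    have h2 : |b j| * |b j| = b j * b j := abs_mul_abs_self _
    field_simp
    by_cases hb : b j = 0
    · simp [hb]
    · apply mul_right_cancel₀ hb
      linear_combination 2 * |b j| * h1 + lam * h2
  have hK : ridgeCore X lam b *ᵥ s = Xᵀ *ᵥ z := by
    have h1 : (lam / 2) • s = residualCorr X z b := by
      ext j; simp only [hs, Pi.smul_apply, smul_eq_mul]; field_simp
    rw [ridgeCore, Matrix.add_mulVec, ← Matrix.mulVec_mulVec, hDs, Matrix.smul_mulVec,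
      Matrix.one_mulVec, h1, residualCorr, Matrix.mulVec_sub, ← Matrix.mulVec_mulVec]
    abel
  rw [← Matrix.mulVec_mulVec, ← hK, Matrix.mulVec_mulVec, ridgeInv_mul_ridgeCore X hlam, hDs]

/-- The residual correlations are, up to scale, subgradients of the `ℓ¹` norm, hence monotone in
`b`. Pairing their difference with `b - b'` gives the inequality. -/
lemma IsLassoSolution.fit_sq_le {X : Matrix (Fin n) (Fin p) ℝ} {lam : ℝ} (hlam : 0 < lam)
    {z z' : Fin n → ℝ} {b b' : Fin p → ℝ} (h : IsLassoSolution X lam z b)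
    (h' : IsLassoSolution X lam z' b') :
    (X *ᵥ (b - b')) ⬝ᵥ (X *ᵥ (b - b')) ≤ (z - z') ⬝ᵥ (X *ᵥ (b - b')) := by
  have hmono : ∀ j, 0 ≤ (residualCorr X z b j - residualCorr X z' b' j) * (b j - b' j) := by
    intro j
    have h1 := h.residualCorr_mul hlam j
    have h2 := h'.residualCorr_mul hlam j
    have h3 : residualCorr X z b j * b' j ≤ lam / 2 * |b' j| := by
      refine (le_abs_self _).trans ?_
      rw [abs_mul]
      exact mul_le_mul_of_nonneg_right (h.abs_residualCorr_le hlam j) (abs_nonneg _)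
    have h4 : residualCorr X z' b' j * b j ≤ lam / 2 * |b j| := by
      refine (le_abs_self _).trans ?_
      rw [abs_mul]
      exact mul_le_mul_of_nonneg_right (h'.abs_residualCorr_le hlam j) (abs_nonneg _)
    linarith
  have hsum : 0 ≤ (residualCorr X z b - residualCorr X z' b') ⬝ᵥ (b - b') :=
    Finset.sum_nonneg fun j _ => hmono j
  rw [sub_dotProduct, residualCorr_dotProduct, residualCorr_dotProduct, ← sub_dotProduct] at hsum
  have : z - X *ᵥ b - (z' - X *ᵥ b') = (z - z') - X *ᵥ (b - b') := by
    rw [Matrix.mulVec_sub]; abel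
  rw [this, sub_dotProduct] at hsum
  linarith

lemma IsLassoSolution.norm_fit_sub_le {X : Matrix (Fin n) (Fin p) ℝ} {lam : ℝ} (hlam : 0 < lam)
    {z z' : Fin n → ℝ} {b b' : Fin p → ℝ} (h : IsLassoSolution X lam z b)
    (h' : IsLassoSolution X lam z' b') :
    ‖X *ᵥ (b - b')‖ ≤ n * ‖z - z'‖ := by
  set w := X *ᵥ (b - b')
  have h1 : w ⬝ᵥ w ≤ (z - z') ⬝ᵥ w := h.fit_sq_le hlam h'
  have h2 : (z - z') ⬝ᵥ w ≤ n * (‖z - z'‖ * ‖w‖) := by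
    calc (z - z') ⬝ᵥ w ≤ ∑ _i : Fin n, ‖z - z'‖ * ‖w‖ := Finset.sum_le_sum fun i _ => by
          refine (le_abs_self _).trans ?_
          rw [abs_mul]
          exact mul_le_mul (norm_le_pi_norm (z - z') i) (norm_le_pi_norm w i) (abs_nonneg _)
            (norm_nonneg _)
      _ = n * (‖z - z'‖ * ‖w‖) := by simp
  refine (pi_norm_le_iff_of_nonneg (by positivity)).2 fun i => ?_
  -- The contradiction hypothesis forces `‖w‖ > 0`, so that one factor `‖w‖` can be cancelled.
  by_contra! hlt
  have hw : 0 < ‖w‖ := lt_of_lt_of_le (lt_of_le_of_lt (by positivity) hlt) (norm_le_pi_norm w i)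
  obtain ⟨k, hk⟩ : ∃ k, ‖w‖ = ‖w k‖ := by
    obtain ⟨k, -, hk⟩ := Finset.exists_max_image Finset.univ (fun k => ‖w k‖) ⟨i, Finset.mem_univ i⟩
    exact ⟨k, le_antisymm ((pi_norm_le_iff_of_nonneg (norm_nonneg _)).2
      fun l => hk l (Finset.mem_univ l)) (norm_le_pi_norm w k)⟩
  have h3 : ‖w‖ * ‖w‖ ≤ w ⬝ᵥ w := by
    rw [hk, Real.norm_eq_abs, abs_mul_abs_self]
    exact Finset.single_le_sum (f := fun k => w k * w k) (fun k _ => mul_self_nonneg _)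
      (Finset.mem_univ k)
  have h4 : ‖w‖ ≤ n * ‖z - z'‖ := by
    refine le_of_mul_le_mul_right ?_ hw
    linarith
  exact absurd ((norm_le_pi_norm w i).trans h4) (not_le.2 hlt)

/-- Moving along `±t v` leaves the fit unchanged, and for small `t` no active sign flips, so the
penalties at `b ± t v` average to the penalty at `b`. Since `b` is optimal, `b + t v` is optimal
too, and uniqueness forces `v = 0`. -/
lemma IsLassoSolution.eq_zero_of_mulVec_eq_zero {X : Matrix (Fin n) (Fin p) ℝ} {lam : ℝ}
    {z : Fin n → ℝ} {b v : Fin p → ℝ} (h : IsLassoSolution X lam z b)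
    (huniq : ∀ b', IsLassoSolution X lam z b' → b' = b) (hv : ∀ j, b j = 0 → v j = 0)
    (hX : X *ᵥ v = 0) : v = 0 := by
  have hloc : ∀ᶠ t : ℝ in 𝓝[>] 0, ∀ j, |b j + t * v j| + |b j - t * v j| = 2 * |b j| := by
    rw [eventually_all]
    intro j
    rcases lt_trichotomy (b j) 0 with hb | hb | hb
    · have h1 : ∀ᶠ t : ℝ in 𝓝 0, b j + t * v j < 0 :=
        (by fun_prop : Continuous fun t : ℝ => b j + t * v j).continuousAt.eventually_lt
          continuousAt_const (by simpa)
      have h2 : ∀ᶠ t : ℝ in 𝓝 0, b j - t * v j < 0 :=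
        (by fun_prop : Continuous fun t : ℝ => b j - t * v j).continuousAt.eventually_lt
          continuousAt_const (by simpa)
      filter_upwards [nhdsWithin_le_nhds h1, nhdsWithin_le_nhds h2] with t ht1 ht2
      rw [abs_of_neg ht1, abs_of_neg ht2, abs_of_neg hb]; ring
    · simp [hb, hv j hb]
    · have h1 : ∀ᶠ t : ℝ in 𝓝 0, 0 < b j + t * v j :=
        continuousAt_const.eventually_lt
          (by fun_prop : Continuous fun t : ℝ => b j + t * v j).continuousAt (by simpa)
      have h2 : ∀ᶠ t : ℝ in 𝓝 0, 0 < b j - t * v j :=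
        continuousAt_const.eventually_lt
          (by fun_prop : Continuous fun t : ℝ => b j - t * v j).continuousAt (by simpa)
      filter_upwards [nhdsWithin_le_nhds h1, nhdsWithin_le_nhds h2] with t ht1 ht2
      rw [abs_of_pos ht1, abs_of_pos ht2, abs_of_pos hb]; ring
  obtain ⟨t, ht, htpos⟩ := (hloc.and self_mem_nhdsWithin).exists
  have hXt : ∀ e : ℝ, X *ᵥ (e • v) = 0 := fun e => by rw [Matrix.mulVec_smul, hX, smul_zero]
  have hobj : ∀ e : ℝ, lassoObjective X lam z (b + e • v) = lassoObjective X lam z b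
      + lam * (∑ j, |b j + e * v j| - ∑ j, |b j|) := by
    intro e
    rw [lassoObjective_add, residualCorr_dotProduct, hXt]
    simp
  have h1 := h (b + (-t) • v)
  rw [hobj] at h1
  have hsum : ∑ j, |b j + t * v j| + ∑ j, |b j + -t * v j| = 2 * ∑ j, |b j| := by
    rw [← Finset.sum_add_distrib, Finset.mul_sum]
    refine Finset.sum_congr rfl fun j _ => ?_
    rw [← ht j, neg_mul, ← sub_eq_add_neg]
  have hsol : IsLassoSolution X lam z (b + t • v) := by
    intro b'
    refine le_trans ?_ (h b')
    rw [hobj]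
    have : ∑ j, |b j + t * v j| - ∑ j, |b j| = -(∑ j, |b j + -t * v j| - ∑ j, |b j|) := by
      linarith
    rw [this]
    linarith
  have := huniq _ hsol
  rw [add_eq_left] at this
  exact (smul_eq_zero.1 this).resolve_left (ne_of_gt htpos)

end Optimality

/-! ### Lipschitz continuity of the solution map -/

section LipschitzSolution

lemma lipschitzWith_of_forall_eventually_norm_sub_le {E F : Type*} [NormedAddCommGroup E]
    [NormedSpace ℝ E] [NormedAddCommGroup F] {f : E → F} (hf : Continuous f)
    {C : ℝ≥0} (h : ∀ x, ∀ᶠ y in 𝓝 x, ‖f y - f x‖ ≤ C * ‖y - x‖) : LipschitzWith C f := by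
  refine LipschitzWith.of_dist_le_mul fun z' z => ?_
  rw [dist_eq_norm, dist_eq_norm]
  set l : ℝ → E := fun t => z + t • (z' - z) with hl
  have hlc : Continuous l := by fun_prop
  -- Along the segment from `z` to `z'` the distance to `f z` has right slopes at most `C‖z' - z‖`,
  -- so it stays below the linear bound.
  have key := image_le_of_liminf_slope_right_le_deriv_boundary (a := 0) (b := 1)
    (f := fun t => ‖f (l t) - f z‖) (B := fun t => C * ‖z' - z‖ * t)
    (B' := fun _ => C * ‖z' - z‖) (by fun_prop) (by simp [hl]) (by fun_prop)
    (fun x _ => by simpa using ((hasDerivAt_id x).const_mul (C * ‖z' - z‖)).hasDerivWithinAt)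
    (fun x _ r hr => by
      apply Eventually.frequently
      have h1 : ∀ᶠ t in 𝓝 x, ‖f (l t) - f (l x)‖ ≤ C * ‖l t - l x‖ :=
        hlc.continuousAt.eventually (h (l x))
      filter_upwards [nhdsWithin_le_nhds h1, self_mem_nhdsWithin] with t ht htx
      have htx' : 0 < t - x := sub_pos.2 htx
      refine lt_of_le_of_lt ?_ hr
      rw [slope_def_field, div_le_iff₀ htx']
      have h2 : l t - l x = (t - x) • (z' - z) := by simp only [hl, sub_smul]; abel
      rw [h2, norm_smul, Real.norm_eq_abs, abs_of_pos htx'] at ht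
      have h3 : ‖f (l t) - f z‖ - ‖f (l x) - f z‖ ≤ ‖f (l t) - f (l x)‖ := by
        have := norm_sub_norm_le (f (l t) - f z) (f (l x) - f z)
        rwa [sub_sub_sub_cancel_right] at this
      linarith)
  have := key (Set.right_mem_Icc.2 zero_le_one)
  simpa [hl] using this

variable {n p : ℕ} {X : Matrix (Fin n) (Fin p) ℝ} {lam : ℝ} {betahat : (Fin n → ℝ) → Fin p → ℝ}

/-- Comparison with `β = 0` confines the solutions near `z` to a compact ball. Optimality passes to
cluster points, and uniqueness leaves only one. -/
lemma continuous_lassoSolution (hlam : 0 < lam)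
    (hbeta : ∀ (z : Fin n → ℝ) (b : Fin p → ℝ), IsLassoSolution X lam z b ↔ b = betahat z) :
    Continuous betahat := by
  rw [continuous_iff_continuousAt]
  intro z
  have hobj : Continuous fun q : (Fin n → ℝ) × (Fin p → ℝ) => lassoObjective X lam q.1 q.2 := by
    unfold lassoObjective Matrix.mulVec dotProduct
    fun_prop
  have hsol : ∀ w, IsLassoSolution X lam w (betahat w) := fun w => (hbeta w _).2 rfl
  refine (isCompact_closedBall (0 : Fin p → ℝ)
    ((∑ i, z i ^ 2 + 1) / lam)).tendsto_nhds_of_unique_mapClusterPt ?_ ?_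
  · have hc : Continuous fun w : Fin n → ℝ => ∑ i, w i ^ 2 := by fun_prop
    filter_upwards [hc.continuousAt.eventually_lt continuousAt_const (lt_add_one (∑ i, z i ^ 2))]
      with w hw
    rw [mem_closedBall_zero_iff]
    refine (pi_norm_le_iff_of_nonneg (by positivity)).2 fun j => ?_
    rw [le_div_iff₀ hlam, Real.norm_eq_abs]
    have h0 := hsol w 0
    have h1 : |betahat w j| ≤ ∑ k, |betahat w k| :=
      Finset.single_le_sum (f := fun k => |betahat w k|) (fun k _ => abs_nonneg _)
        (Finset.mem_univ j)
    have h2 : 0 ≤ ∑ i, (w i - (X *ᵥ betahat w) i) ^ 2 := Finset.sum_nonneg fun i _ => sq_nonneg _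
    simp only [lassoObjective, Matrix.mulVec_zero, Pi.zero_apply, sub_zero, abs_zero,
      Finset.sum_const_zero, mul_zero, add_zero] at h0
    nlinarith
  · intro b _ hb
    rw [mapClusterPt_iff_ultrafilter] at hb
    obtain ⟨U, hU, hUb⟩ := hb
    refine (hbeta z b).1 fun b' => ?_
    have hUz : Tendsto (fun w : Fin n → ℝ => w) U (𝓝 z) := hU
    refine le_of_tendsto_of_tendsto
      ((hobj.tendsto (z, b)).comp (hUz.prodMk_nhds hUb))
      ((hobj.tendsto (z, b')).comp (hUz.prodMk_nhds tendsto_const_nhds)) ?_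
    exact Eventually.of_forall fun w => hsol w b'

lemma exists_norm_le_mul_norm_mulVec (X : Matrix (Fin n) (Fin p) ℝ) (A : Set (Fin p))
    (hA : ∀ v : Fin p → ℝ, (∀ j ∉ A, v j = 0) → X *ᵥ v = 0 → v = 0) :
    ∃ C : ℝ≥0, ∀ v : Fin p → ℝ, (∀ j ∉ A, v j = 0) → ‖v‖ ≤ C * ‖X *ᵥ v‖ := by
  let V : Submodule ℝ (Fin p → ℝ) :=
    { carrier := {v | ∀ j ∉ A, v j = 0}
      add_mem' := fun {a b} ha hb j hj => by simp [ha j hj, hb j hj]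
      zero_mem' := fun j _ => rfl
      smul_mem' := fun c a ha j hj => by simp [ha j hj] }
  obtain ⟨K, -, hK⟩ := (X.mulVecLin.domRestrict V).exists_antilipschitzWith (by
    rw [LinearMap.ker_eq_bot']
    rintro ⟨v, hv⟩ h
    exact Subtype.ext (hA v hv h))
  refine ⟨K, fun v hv => ?_⟩
  simpa using hK.le_mul_norm (map_zero _) (⟨v, hv⟩ : V)

lemma exists_lipschitzWith_lassoSolution (hlam : 0 < lam)
    (hbeta : ∀ (z : Fin n → ℝ) (b : Fin p → ℝ), IsLassoSolution X lam z b ↔ b = betahat z) :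
    ∃ C, LipschitzWith C betahat := by
  classical
  have hcont := continuous_lassoSolution hlam hbeta
  have hsol : ∀ w, IsLassoSolution X lam w (betahat w) := fun w => (hbeta w _).2 rfl
  have hC : ∀ A : Set (Fin p), ∃ C : ℝ≥0,
      (∀ v : Fin p → ℝ, (∀ j ∉ A, v j = 0) → X *ᵥ v = 0 → v = 0) →
      ∀ v : Fin p → ℝ, (∀ j ∉ A, v j = 0) → ‖v‖ ≤ C * ‖X *ᵥ v‖ := by
    intro A
    by_cases hA : ∀ v : Fin p → ℝ, (∀ j ∉ A, v j = 0) → X *ᵥ v = 0 → v = 0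
    · obtain ⟨C, hC⟩ := exists_norm_le_mul_norm_mulVec X A hA
      exact ⟨C, fun _ => hC⟩
    · exact ⟨0, fun h => absurd h hA⟩
  choose C hC using hC
  -- The factor `n` is the sup-norm Lipschitz constant of the fit; summing over all subsets gives a
  -- constant independent of the support.
  refine ⟨(∑ A, C A) * n, lipschitzWith_of_forall_eventually_norm_sub_le hcont fun z => ?_⟩
  have hsupp : ∀ᶠ w in 𝓝 z, ∀ j, betahat z j ≠ 0 → betahat w j ≠ 0 := by
    rw [eventually_all]
    intro j
    by_cases hj : betahat z j = 0
    · simp [hj]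
    · have hcj : ContinuousAt (fun w => betahat w j) z :=
        ((continuous_apply j).comp hcont).continuousAt
      filter_upwards [hcj.eventually_ne hj] with w hw _ using hw
  filter_upwards [hsupp] with w hw
  -- Near `z` the support can only grow, so `β̂(w) - β̂(z)` is supported on the support of `β̂(w)`,
  -- where `X` is injective.
  set A : Set (Fin p) := {j | betahat w j ≠ 0} with hA
  have h1 : ‖betahat w - betahat z‖ ≤ C A * ‖X *ᵥ (betahat w - betahat z)‖ := by
    refine hC A (fun v hv hXv => ?_) _ fun j hj => ?_
    · refine (hsol w).eq_zero_of_mulVec_eq_zero (fun b' hb' => (hbeta w b').1 hb') (fun j hj => ?_)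
        hXv
      exact hv j (by simp [hA, hj])
    · have h0 : betahat w j = 0 := by simpa [hA] using hj
      have h0' : betahat z j = 0 := by
        by_contra h
        exact hw j h h0
      simp [h0, h0']
  have h2 := (hsol w).norm_fit_sub_le hlam (hsol z)
  have h3 : (C A : ℝ) ≤ ∑ B, (C B : ℝ) :=
    Finset.single_le_sum (f := fun B => (C B : ℝ)) (fun B _ => (C B).2) (Finset.mem_univ A)
  calc ‖betahat w - betahat z‖ ≤ C A * ‖X *ᵥ (betahat w - betahat z)‖ := h1
    _ ≤ (∑ B, (C B : ℝ)) * (n * ‖w - z‖) := by gcongr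
    _ = _ := by push_cast; ring

end LipschitzSolution

/-! ### Entrywise calculus for matrix-valued functions -/

section MatrixDeriv

variable {n : ℕ} {l m k : Type*} [Fintype m]

/-- The entrywise partial derivative `∂A/∂z_i` of a matrix-valued function. -/
noncomputable def matrixPDeriv (i : Fin n) (A : (Fin n → ℝ) → Matrix l k ℝ) (z : Fin n → ℝ) :
    Matrix l k ℝ :=
  Matrix.of fun r s => pderiv i (fun w => A w r s) z

lemma HasLineDerivAt.matrixPDeriv_apply {i : Fin n} {A : (Fin n → ℝ) → Matrix l k ℝ}
    {z : Fin n → ℝ} {r : l} {s : k} {a : ℝ}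
    (h : HasLineDerivAt ℝ (fun w => A w r s) a z (Pi.single i 1)) : matrixPDeriv i A z r s = a :=
  h.lineDeriv

lemma DifferentiableAt.hasLineDerivAt_pderiv {f : (Fin n → ℝ) → ℝ} {z : Fin n → ℝ}
    (h : DifferentiableAt ℝ f z) (i : Fin n) :
    HasLineDerivAt ℝ f (pderiv i f z) z (Pi.single i 1) :=
  h.lineDifferentiableAt.hasLineDerivAt

lemma matrixPDeriv_const (i : Fin n) (A : Matrix l k ℝ) (z : Fin n → ℝ) :
    matrixPDeriv i (fun _ => A) z = 0 := by
  ext r s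
  simp [matrixPDeriv, pderiv, lineDeriv]

lemma differentiableAt_matrix_mul {A : (Fin n → ℝ) → Matrix l m ℝ} {B : (Fin n → ℝ) → Matrix m k ℝ}
    {z : Fin n → ℝ} (hA : ∀ r s, DifferentiableAt ℝ (fun w => A w r s) z)
    (hB : ∀ r s, DifferentiableAt ℝ (fun w => B w r s) z) (r : l) (s : k) :
    DifferentiableAt ℝ (fun w => (A w * B w) r s) z := by
  simp only [Matrix.mul_apply]
  exact DifferentiableAt.fun_sum fun t _ => (hA r t).mul (hB t s)

lemma matrixPDeriv_mul {A : (Fin n → ℝ) → Matrix l m ℝ} {B : (Fin n → ℝ) → Matrix m k ℝ}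
    {z : Fin n → ℝ} (hA : ∀ r s, DifferentiableAt ℝ (fun w => A w r s) z)
    (hB : ∀ r s, DifferentiableAt ℝ (fun w => B w r s) z) (i : Fin n) :
    matrixPDeriv i (fun w => A w * B w) z
      = matrixPDeriv i A z * B z + A z * matrixPDeriv i B z := by
  ext r s
  apply HasLineDerivAt.matrixPDeriv_apply
  simp only [Matrix.mul_apply, Matrix.add_apply, ← Finset.sum_add_distrib]
  unfold HasLineDerivAt
  refine HasDerivAt.fun_sum fun t _ => ?_
  have h1 := (hA r t).hasLineDerivAt_pderiv i
  have h2 := (hB t s).hasLineDerivAt_pderiv i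
  simpa [matrixPDeriv] using HasDerivAt.fun_mul h1 h2

lemma differentiableAt_matrix_det [DecidableEq m] {A : (Fin n → ℝ) → Matrix m m ℝ}
    {z : Fin n → ℝ} (hA : ∀ r s, DifferentiableAt ℝ (fun w => A w r s) z) :
    DifferentiableAt ℝ (fun w => (A w).det) z := by
  simp only [Matrix.det_apply, Units.smul_def, zsmul_eq_mul]
  refine DifferentiableAt.fun_sum fun τ _ => ?_
  have h : DifferentiableAt ℝ (fun w => ∏ r, A w (τ r) r) z :=
    (HasFDerivAt.finsetProd fun r _ => (hA (τ r) r).hasFDerivAt).differentiableAt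
  exact h.const_mul _

lemma differentiableAt_matrix_inv [DecidableEq m] {A : (Fin n → ℝ) → Matrix m m ℝ}
    {z : Fin n → ℝ} (hA : ∀ r s, DifferentiableAt ℝ (fun w => A w r s) z) (h0 : IsUnit (A z))
    (r s : m) : DifferentiableAt ℝ (fun w => (A w)⁻¹ r s) z := by
  simp only [Matrix.inv_def, Ring.inverse_eq_inv', Matrix.smul_apply, smul_eq_mul,
    Matrix.adjugate_apply]
  refine DifferentiableAt.mul (DifferentiableAt.inv (differentiableAt_matrix_det hA)
    ((Matrix.isUnit_iff_isUnit_det _).1 h0).ne_zero) (differentiableAt_matrix_det fun t u => ?_)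
  by_cases ht : t = s
  · subst ht; simp
  · simpa [Matrix.updateRow_ne ht] using hA t u

end MatrixDeriv

/-! ### Differentiability of the smoother and the formula for its derivative -/

section SmootherDeriv

variable {n p : ℕ} {X : Matrix (Fin n) (Fin p) ℝ} {lam : ℝ} {betahat : (Fin n → ℝ) → Fin p → ℝ}

/-- A positive coefficient forces residual correlation `λ/2`, a negative one `-λ/2`. The correlation
is continuous, so one of the two values is avoided near `z`. -/
lemma eventually_nonneg_or_eventually_nonpos_lassoSolution (hlam : 0 < lam)
    (hcont : Continuous betahat) (hsol : ∀ w, IsLassoSolution X lam w (betahat w))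
    (z : Fin n → ℝ) (j : Fin p) :
    (∀ᶠ w in 𝓝 z, 0 ≤ betahat w j) ∨ ∀ᶠ w in 𝓝 z, betahat w j ≤ 0 := by
  have hr : Continuous fun w => residualCorr X w (betahat w) j := by
    unfold residualCorr Matrix.mulVec dotProduct
    fun_prop
  by_cases h : residualCorr X z (betahat z) j = -(lam / 2)
  · right
    filter_upwards [hr.continuousAt.eventually_lt continuousAt_const
      (show residualCorr X z (betahat z) j < lam / 2 by rw [h]; linarith)] with w hw
    by_contra! hb
    have := (hsol w).residualCorr_mul hlam j
    rw [abs_of_pos hb] at this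
    exact absurd (mul_right_cancel₀ hb.ne' this) hw.ne
  · left
    filter_upwards [hr.continuousAt.eventually_ne h] with w hw
    by_contra! hb
    have := (hsol w).residualCorr_mul hlam j
    rw [abs_of_neg hb, mul_neg, ← neg_mul] at this
    exact hw (mul_right_cancel₀ hb.ne this)

lemma differentiableAt_abs_lassoSolution (hlam : 0 < lam)
    (hcont : Continuous betahat) (hsol : ∀ w, IsLassoSolution X lam w (betahat w))
    {z : Fin n → ℝ} (hz : DifferentiableAt ℝ betahat z) (j : Fin p) :
    DifferentiableAt ℝ (fun w => |betahat w j|) z := by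
  have hj : DifferentiableAt ℝ (fun w => betahat w j) z := differentiableAt_pi.1 hz j
  rcases eventually_nonneg_or_eventually_nonpos_lassoSolution hlam hcont hsol z j with h | h
  · refine hj.congr_of_eventuallyEq ?_
    filter_upwards [h] with w hw using abs_of_nonneg hw
  · refine hj.neg.congr_of_eventuallyEq ?_
    filter_upwards [h] with w hw using abs_of_nonpos hw

lemma pderiv_abs {f : (Fin n → ℝ) → ℝ} {z : Fin n → ℝ} (hf : DifferentiableAt ℝ f z)
    (hfa : DifferentiableAt ℝ (fun w => |f w|) z) (i : Fin n) :
    pderiv i (fun w => |f w|) z = Real.sign (f z) * pderiv i f z := by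
  unfold pderiv
  rcases lt_trichotomy (f z) 0 with h | h | h
  · have : (fun w => |f w|) =ᶠ[𝓝 z] fun w => -f w := by
      filter_upwards [hf.continuousAt.eventually_lt continuousAt_const h] with w hw
        using abs_of_neg hw
    rw [this.lineDeriv_eq, Real.sign_of_neg h, neg_one_mul]
    have h1 := (hf.hasLineDerivAt_pderiv i).neg
    exact HasLineDerivAt.lineDeriv h1
  · rw [h, Real.sign_zero, zero_mul, hfa.lineDeriv_eq_fderiv]
    -- At a zero of `f` the function `|f|` has a minimum, so its derivative vanishes, in agreement
    -- with `sign 0 = 0`.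
    have : IsLocalMin (fun w => |f w|) z :=
      Eventually.of_forall fun w => by simp [h]
    rw [this.fderiv_eq_zero]
    simp
  · have : (fun w => |f w|) =ᶠ[𝓝 z] f := by
      filter_upwards [continuousAt_const.eventually_lt hf.continuousAt h] with w hw
        using abs_of_pos hw
    rw [this.lineDeriv_eq, Real.sign_of_pos h, one_mul]

lemma differentiableAt_ridgeInv {b : (Fin n → ℝ) → Fin p → ℝ} (hlam : 0 < lam) {z : Fin n → ℝ}
    (hb : ∀ j, DifferentiableAt ℝ (fun w => |b w j|) z) (r s : Fin p) :
    DifferentiableAt ℝ (fun w => ridgeInv X lam (b w) r s) z := by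
  have hD : ∀ r s, DifferentiableAt ℝ (fun w => Matrix.diagonal (fun j => |b w j|) r s) z := by
    intro r s
    by_cases h : r = s
    · subst h; simpa using hb r
    · simp [h]
  simp only [ridgeInv_eq X hlam]
  refine differentiableAt_matrix_mul hD (differentiableAt_matrix_inv (fun r s => ?_)
    (isUnit_ridgeCore X hlam (b z))) r s
  simp only [ridgeCore, Matrix.add_apply]
  exact (differentiableAt_matrix_mul (A := fun _ => Xᵀ * X) (fun _ _ => differentiableAt_const _)
    hD r s).fun_add (differentiableAt_const _)

/-- Differentiating `R K = D` gives `R' K + R XᵀX D' = D'`. Multiplying by `Kᵀ` and using `Kᵀ R =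
D`, which holds because `R` is symmetric, leaves `Kᵀ R' K = (λ/2) D'`. The claimed formula satisfies
the same equation, and `Kᵀ` and `K` cancel. -/
lemma matrixPDeriv_ridgeInv {b : (Fin n → ℝ) → Fin p → ℝ} (hlam : 0 < lam) {z : Fin n → ℝ}
    (hb : ∀ j, DifferentiableAt ℝ (fun w => b w j) z)
    (hba : ∀ j, DifferentiableAt ℝ (fun w => |b w j|) z) (i : Fin n) :
    matrixPDeriv i (fun w => ridgeInv X lam (b w)) z =
      -(lam • (ridgeInv X lam (b z) * signMatrix (b z) * coefDerivMatrix b i z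
        * ridgeInv X lam (b z))) := by
  set D' : Matrix (Fin p) (Fin p) ℝ :=
    Matrix.diagonal fun j => Real.sign (b z j) * pderiv i (fun w => b w j) z with hD'
  have hdiff : ∀ r s, DifferentiableAt ℝ (fun w => Matrix.diagonal (fun j => |b w j|) r s) z := by
    intro r s
    by_cases h : r = s
    · subst h; simpa using hba r
    · simp [h]
  have hcore : ∀ r s, DifferentiableAt ℝ (fun w => ridgeCore X lam (b w) r s) z := by
    intro r s
    simp only [ridgeCore, Matrix.add_apply]
    exact (differentiableAt_matrix_mul (A := fun _ => Xᵀ * X) (fun _ _ => differentiableAt_const _)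
      hdiff r s).fun_add (differentiableAt_const _)
  have hDd : matrixPDeriv i (fun w => Matrix.diagonal (fun j => |b w j|)) z = D' := by
    ext r s
    by_cases h : r = s
    · subst h
      simp only [matrixPDeriv, Matrix.of_apply, hD', Matrix.diagonal_apply_eq]
      exact pderiv_abs (hb r) (hba r) i
    · simp [matrixPDeriv, hD', h, pderiv, lineDeriv]
  have hKd : matrixPDeriv i (fun w => ridgeCore X lam (b w)) z = Xᵀ * X * D' := by
    have h1 := matrixPDeriv_mul (A := fun _ => Xᵀ * X) (fun _ _ => differentiableAt_const _) hdiff i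
    rw [matrixPDeriv_const, zero_mul, zero_add, hDd] at h1
    rw [← h1]
    ext r s
    simp only [matrixPDeriv, Matrix.of_apply, ridgeCore, Matrix.add_apply, pderiv, lineDeriv,
      deriv_add_const]
  set K := ridgeCore X lam (b z) with hK
  set R := ridgeInv X lam (b z) with hR
  have hKu : IsUnit K.det :=
    (Matrix.isUnit_iff_isUnit_det _).1 (isUnit_ridgeCore X hlam (b z))
  have hRK : matrixPDeriv i (fun w => ridgeInv X lam (b w)) z * K + R * (Xᵀ * X * D') = D' := by
    have h1 := matrixPDeriv_mul (differentiableAt_ridgeInv (X := X) hlam hba) hcore i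
    simp only [ridgeInv_mul_ridgeCore X hlam] at h1
    rw [hDd, hKd] at h1
    exact h1.symm
  set D : Matrix (Fin p) (Fin p) ℝ := Matrix.diagonal fun j => |b z j| with hD
  have hRD : R * K = D := ridgeInv_mul_ridgeCore X hlam (b z)
  have hRD' : Kᵀ * R = D := by
    have := congrArg Matrix.transpose hRD
    rwa [Matrix.transpose_mul, hR, transpose_ridgeInv, hD, Matrix.diagonal_transpose] at this
  have hKt : Kᵀ = D * (Xᵀ * X) + (lam / 2) • 1 := by
    rw [hK, ridgeCore, Matrix.transpose_add, Matrix.transpose_mul, Matrix.transpose_mul,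
      Matrix.transpose_transpose, Matrix.diagonal_transpose, Matrix.transpose_smul,
      Matrix.transpose_one]
  have hKtu : IsUnit Kᵀ.det := by rwa [Matrix.det_transpose]
  -- The outer factors `|b_j|` cancel the denominator `2 b_j²` of `C`; where `b_j = 0` both sides
  -- are zero.
  have hDD : D * (signMatrix (b z) * coefDerivMatrix b i z) * D = -((1 / 2 : ℝ) • D') := by
    rw [hD, hD', signMatrix, coefDerivMatrix, Matrix.diagonal_mul_diagonal,
      Matrix.diagonal_mul_diagonal, Matrix.diagonal_mul_diagonal, ← Matrix.diagonal_smul,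
      Matrix.diagonal_neg]
    congr 1
    ext j
    simp only [Pi.smul_apply, smul_eq_mul]
    by_cases h : b z j = 0
    · simp [h]
    · have h2 : |b z j| * |b z j| = b z j ^ 2 := by rw [abs_mul_abs_self, sq]
      field_simp
      linear_combination (-(Real.sign (b z j) * pderiv i (fun w => b w j) z)) * h2
  have hleft : Kᵀ * (matrixPDeriv i (fun w => ridgeInv X lam (b w)) z) * K = (lam / 2) • D' := by
    have h1 : matrixPDeriv i (fun w => ridgeInv X lam (b w)) z * K = D' - R * (Xᵀ * X * D') :=
      eq_sub_of_add_eq hRK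
    rw [mul_assoc, h1, mul_sub, ← mul_assoc Kᵀ R, hRD', hKt, add_mul, smul_mul_assoc, one_mul,
      ← mul_assoc D, add_sub_cancel_left]
  have hright : Kᵀ * (-(lam • (R * signMatrix (b z) * coefDerivMatrix b i z * R))) * K
      = (lam / 2) • D' := by
    have h1 : Kᵀ * (R * signMatrix (b z) * coefDerivMatrix b i z * R) * K
        = (Kᵀ * R) * (signMatrix (b z) * coefDerivMatrix b i z) * (R * K) := by
      simp only [mul_assoc]
    rw [mul_neg, neg_mul, mul_smul_comm, smul_mul_assoc, h1, hRD, hRD', hDD, smul_neg, neg_neg,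
      smul_smul]
    congr 1; ring
  have heq := hleft.trans hright.symm
  exact ((Matrix.isUnit_iff_isUnit_det _).2 hKtu).mul_left_cancel
    (((Matrix.isUnit_iff_isUnit_det _).2 hKu).mul_right_cancel heq)

lemma differentiableAt_lassoSmoother (hlam : 0 < lam)
    (hcont : Continuous betahat) (hsol : ∀ w, IsLassoSolution X lam w (betahat w))
    {z : Fin n → ℝ} (hz : DifferentiableAt ℝ betahat z) (r s : Fin n) :
    DifferentiableAt ℝ (fun w => lassoSmoother X lam betahat w r s) z :=
  differentiableAt_matrix_mul (B := fun _ => Xᵀ)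
    (differentiableAt_matrix_mul (A := fun _ => X) (fun _ _ => differentiableAt_const _)
      (differentiableAt_ridgeInv hlam (differentiableAt_abs_lassoSolution hlam hcont hsol hz)))
    (fun _ _ => differentiableAt_const _) r s

lemma matrixPDeriv_lassoSmoother (hlam : 0 < lam)
    (hcont : Continuous betahat) (hsol : ∀ w, IsLassoSolution X lam w (betahat w))
    {z : Fin n → ℝ} (hz : DifferentiableAt ℝ betahat z) (i : Fin n) :
    matrixPDeriv i (lassoSmoother X lam betahat) z =
      -(lam • (X * ridgeInv X lam (betahat z) * signMatrix (betahat z) *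
        coefDerivMatrix betahat i z * ridgeInv X lam (betahat z) * Xᵀ)) := by
  have hba := differentiableAt_abs_lassoSolution hlam hcont hsol hz
  have hX : ∀ r s, DifferentiableAt ℝ (fun _ : Fin n → ℝ => X r s) z :=
    fun _ _ => differentiableAt_const _
  have hXt : ∀ r s, DifferentiableAt ℝ (fun _ : Fin n → ℝ => Xᵀ r s) z :=
    fun _ _ => differentiableAt_const _
  have hR := differentiableAt_ridgeInv (X := X) hlam hba
  have h1 := matrixPDeriv_mul (differentiableAt_matrix_mul hX hR) hXt i
  rw [matrixPDeriv_mul hX hR, matrixPDeriv_const, matrixPDeriv_const, Matrix.zero_mul, zero_add, Matrix.mul_zero,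
    add_zero, matrixPDeriv_ridgeInv hlam (differentiableAt_pi.1 hz) hba] at h1
  refine Eq.trans h1 ?_
  simp only [Matrix.mul_assoc, Matrix.mul_neg, Matrix.neg_mul, Matrix.mul_smul, Matrix.smul_mul]

end SmootherDeriv

/-! ### Stein's identity for Lipschitz functions -/

section Stein

lemma LipschitzWith.memLp_comp {α E F : Type*} [MeasurableSpace α] {μ : Measure α}
    [IsFiniteMeasure μ] [NormedAddCommGroup E] [NormedAddCommGroup F] {q : ℝ≥0∞} {C : ℝ≥0}
    {g : E → F} {f : α → E} (hg : LipschitzWith C g) (hf : MemLp f q μ) :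
    MemLp (fun x => g (f x)) q μ := by
  have h0 : LipschitzWith C fun x => g x - g 0 := by
    refine LipschitzWith.of_dist_le_mul fun x y => ?_
    rw [dist_sub_right]
    exact hg.dist_le_mul x y
  have h1 := (h0.comp_memLp (by simp) hf).add (memLp_const (g 0))
  refine h1.ae_eq (Eventually.of_forall fun x => ?_)
  simp

lemma hasDerivAt_gaussianPDFReal (m : ℝ) (v : ℝ≥0) (x : ℝ) :
    HasDerivAt (gaussianPDFReal m v) (-((x - m) / v) * gaussianPDFReal m v x) x := by
  have h1 : HasDerivAt (fun x : ℝ => -(x - m) ^ 2 / (2 * v)) (-((x - m) / v)) x := by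
    have := ((((hasDerivAt_id x).sub_const m).pow 2).neg).div_const (2 * (v : ℝ))
    refine this.congr_deriv ?_
    simp only [id, Nat.cast_ofNat, mul_one]
    by_cases hv : (v : ℝ) = 0
    · simp [hv]
    · field_simp
      norm_num
  refine ((h1.exp).const_mul (√(2 * Real.pi * v))⁻¹).congr_deriv ?_
  rw [gaussianPDFReal]
  ring

/-- A Lipschitz function grows at most linearly, which the Gaussian density outweighs; this kills
the boundary terms in Stein's identity. -/
lemma tendsto_mul_gaussianPDFReal_cocompact {h : ℝ → ℝ} {C : ℝ≥0} (hh : LipschitzWith C h) (m : ℝ)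
    {v : ℝ≥0} (hv : v ≠ 0) :
    Tendsto (fun x => h x * gaussianPDFReal m v x) (cocompact ℝ) (𝓝 0) := by
  have hv' : (0 : ℝ) < v := NNReal.coe_pos.2 (pos_iff_ne_zero.2 hv)
  have ha : (0 : ℝ) < 1 / (2 * v) := by positivity
  set a : ℝ := 1 / (2 * v) with hadef
  set c : ℝ := (√(2 * Real.pi * v))⁻¹
  have hb : Tendsto (fun u : ℝ => |h m| * c * (|u| ^ (0 : ℝ) * Real.exp (-a * u ^ 2))
      + C * c * (|u| ^ (1 : ℝ) * Real.exp (-a * u ^ 2))) (cocompact ℝ) (𝓝 0) := by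
    simpa using ((tendsto_rpow_abs_mul_exp_neg_mul_sq_cocompact ha 0).const_mul (|h m| * c)).add
      ((tendsto_rpow_abs_mul_exp_neg_mul_sq_cocompact ha 1).const_mul (C * c))
  have hs : Tendsto (fun x : ℝ => x - m) (cocompact ℝ) (cocompact ℝ) :=
    (Homeomorph.subRight m).isClosedEmbedding.tendsto_cocompact
  refine squeeze_zero_norm (fun x => ?_) (hb.comp hs)
  have h1 : |h x| ≤ |h m| + C * |x - m| := by
    have := hh.dist_le_mul x m
    rw [Real.dist_eq, Real.dist_eq] at this
    have h2 := abs_sub_abs_le_abs_sub (h x) (h m)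
    linarith
  have hg : gaussianPDFReal m v x = c * Real.exp (-a * (x - m) ^ 2) := by
    rw [gaussianPDFReal, hadef]
    congr 2
    ring
  have hc : 0 ≤ c := by positivity
  simp only [Function.comp_apply, Real.rpow_zero, Real.rpow_one, one_mul]
  rw [Real.norm_eq_abs, abs_mul, abs_of_nonneg (gaussianPDFReal_nonneg m v x), hg]
  calc |h x| * (c * Real.exp (-a * (x - m) ^ 2))
      ≤ (|h m| + C * |x - m|) * (c * Real.exp (-a * (x - m) ^ 2)) := by gcongr
    _ = _ := by ring

lemma integrable_gaussianReal_iff {m : ℝ} {v : ℝ≥0} (hv : v ≠ 0) {g : ℝ → ℝ} :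
    Integrable g (gaussianReal m v) ↔ Integrable fun x => gaussianPDFReal m v x * g x := by
  rw [gaussianReal_of_var_ne_zero _ hv, integrable_withDensity_iff_integrable_smul'
    (measurable_gaussianPDF m v) (Eventually.of_forall fun _ => gaussianPDF_lt_top)]
  simp only [toReal_gaussianPDF, smul_eq_mul]

lemma integrable_of_forall_norm_le {α : Type*} [MeasurableSpace α] {μ : Measure α}
    [IsFiniteMeasure μ] {f : α → ℝ} (hf : Measurable f) {C : ℝ} (h : ∀ x, ‖f x‖ ≤ C) :
    Integrable f μ :=
  (memLp_top_of_bound hf.aestronglyMeasurable C (Eventually.of_forall h)).integrable le_top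

/-- Stein's identity for Lipschitz functions of one Gaussian variable. -/
lemma integral_mul_sub_gaussianReal {h : ℝ → ℝ} {C : ℝ≥0} (hh : LipschitzWith C h) (m : ℝ)
    {v : ℝ≥0} (hv : v ≠ 0) :
    ∫ x, h x * (x - m) ∂gaussianReal m v = v * ∫ x, deriv h x ∂gaussianReal m v := by
  have hv' : (v : ℝ) ≠ 0 := NNReal.coe_ne_zero.2 hv
  set φ := gaussianPDFReal m v with hφ
  have hφd : deriv φ = fun x => -((x - m) / v) * φ x :=
    funext fun x => (hasDerivAt_gaussianPDFReal m v x).deriv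
  have hφc : ContDiff ℝ 1 φ := by
    rw [hφ, gaussianPDFReal_def]
    fun_prop
  have hid : MemLp (fun x : ℝ => x) 2 (gaussianReal m v) := memLp_id_gaussianReal 2
  have hi1 : Integrable (fun x => h x * (x - m)) (gaussianReal m v) :=
    (hh.memLp_comp hid).integrable_mul (hid.sub (memLp_const m))
  have hi2 : Integrable (deriv h) (gaussianReal m v) :=
    integrable_of_forall_norm_le (measurable_deriv h) fun x => norm_deriv_le_of_lipschitz hh
  rw [integrable_gaussianReal_iff hv] at hi1 hi2
  have hi3 : Integrable fun x => h x * deriv φ x := by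
    refine (hi1.const_mul (-(v : ℝ)⁻¹)).congr (Eventually.of_forall fun x => ?_)
    simp only [hφd]
    simp only [hφ]
    ring
  have hi4 : Integrable fun x => deriv h x * φ x := by
    refine hi2.congr (Eventually.of_forall fun x => mul_comm _ _)
  -- Since `h` is only Lipschitz, integration by parts is used in its absolutely continuous form on
  -- `[-R, R]`, before `R → ∞`.
  have hparts : ∀ R : ℝ, ∫ x in (-R)..R, h x * deriv φ x
      = h R * φ R - h (-R) * φ (-R) - ∫ x in (-R)..R, deriv h x * φ x := fun R =>
    AbsolutelyContinuousOnInterval.integral_mul_deriv_eq_deriv_mul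
      (hh.lipschitzOnWith.absolutelyContinuousOnInterval)
      (hφc.contDiffOn.absolutelyContinuousOnInterval)
  have hl := intervalIntegral_tendsto_integral hi3 tendsto_neg_atTop_atBot tendsto_id
  have hr := intervalIntegral_tendsto_integral hi4 tendsto_neg_atTop_atBot tendsto_id
  have hbd := tendsto_mul_gaussianPDFReal_cocompact hh m hv
  have hb1 : Tendsto (fun R : ℝ => h R * φ R) atTop (𝓝 0) := hbd.mono_left atTop_le_cocompact
  have hb2 : Tendsto (fun R : ℝ => h (-R) * φ (-R)) atTop (𝓝 0) :=
    (hbd.mono_left atBot_le_cocompact).comp tendsto_neg_atTop_atBot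
  have heq : ∫ x, h x * deriv φ x = -∫ x, deriv h x * φ x := by
    refine tendsto_nhds_unique hl ?_
    simp only [id, hparts]
    simpa using (hb1.sub hb2).sub hr
  rw [integral_gaussianReal_eq_integral_smul hv, integral_gaussianReal_eq_integral_smul hv]
  simp only [smul_eq_mul]
  have e1 : ∫ x, gaussianPDFReal m v x * (h x * (x - m)) = -(v : ℝ) * ∫ x, h x * deriv φ x := by
    rw [← integral_const_mul]
    congr 1
    ext x
    simp only [hφd]
    simp only [hφ]
    field_simp
  rw [e1, heq, neg_mul_neg]
  congr 2
  ext x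
  exact mul_comm _ _

/-- Resampling one coordinate independently preserves a product law. This allows Fubini in
coordinate `i` without splitting the index set. -/
lemma measurePreserving_update_prod {ι : Type*} [Fintype ι] [DecidableEq ι] {α : ι → Type*}
    [∀ j, MeasurableSpace (α j)] (γ : ∀ j, Measure (α j)) [∀ j, IsProbabilityMeasure (γ j)]
    (i : ι) :
    MeasurePreserving (fun q : (∀ j, α j) × α i => Function.update q.1 i q.2)
      ((Measure.pi γ).prod (γ i)) (Measure.pi γ) := by
  have hm : Measurable fun q : (∀ j, α j) × α i => Function.update q.1 i q.2 := by
    rw [measurable_pi_iff]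
    intro j
    by_cases h : j = i
    · subst h
      simpa using measurable_snd
    · simp only [Function.update_of_ne h]
      exact (measurable_pi_apply j).comp measurable_fst
  refine ⟨hm, (Measure.pi_eq fun s hs => ?_).symm⟩
  rw [Measure.map_apply hm (MeasurableSet.univ_pi hs)]
  -- The old value of coordinate `i` is discarded, hence unconstrained; the fresh one must lie in `s
  -- i`.
  have hpre : (fun q : (∀ j, α j) × α i => Function.update q.1 i q.2) ⁻¹' Set.univ.pi s
      = (Set.univ.pi (Function.update s i Set.univ)) ×ˢ s i := by
    ext q
    simp only [Set.mem_preimage, Set.mem_univ_pi, Set.mem_prod]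
    constructor
    · intro h
      refine ⟨fun j => ?_, by simpa using h i⟩
      by_cases hj : j = i
      · subst hj; simp
      · simpa [Function.update_of_ne hj] using h j
    · rintro ⟨h1, h2⟩ j
      by_cases hj : j = i
      · subst hj; simpa using h2
      · simpa [Function.update_of_ne hj] using h1 j
  rw [hpre, Measure.prod_prod, Measure.pi_pi, ← Finset.mul_prod_erase _ _ (Finset.mem_univ i),
    ← Finset.mul_prod_erase Finset.univ (fun j => γ j (s j)) (Finset.mem_univ i)]
  simp only [Function.update_self, measure_univ, one_mul]
  rw [mul_comm]
  congr 1
  refine Finset.prod_congr rfl fun j hj => ?_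
  rw [Function.update_of_ne (Finset.ne_of_mem_erase hj)]

lemma absolutelyContinuous_pi {n : ℕ} (γ ν : Fin n → Measure ℝ) [∀ i, SigmaFinite (γ i)]
    [∀ i, SigmaFinite (ν i)] (h : ∀ i, γ i ≪ ν i) : Measure.pi γ ≪ Measure.pi ν := by
  induction n with
  | zero => rw [Measure.pi_of_empty γ, Measure.pi_of_empty ν]
  | succ n ih =>
    have h1 := (measurePreserving_piFinSuccAbove γ 0).symm.map_eq
    have h2 := (measurePreserving_piFinSuccAbove ν 0).symm.map_eq
    rw [← h1, ← h2]
    exact ((h 0).prod (ih _ _ fun i => h _)).map (MeasurableEquiv.measurable _)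

variable {n : ℕ}

lemma pderiv_update (f : (Fin n → ℝ) → ℝ) (i : Fin n) (x : Fin n → ℝ) (t : ℝ) :
    pderiv i f (Function.update x i t) = deriv (fun s => f (Function.update x i s)) t := by
  have h : ∀ s : ℝ, Function.update x i t + s • Pi.single i 1 = Function.update x i (t + s) := by
    intro s
    ext j
    by_cases hj : j = i
    · subst hj; simp
    · simp [hj]
  rw [pderiv, lineDeriv]
  simp only [h]
  rw [deriv_comp_const_add (fun s => f (Function.update x i s)), add_zero]

lemma norm_pderiv_le {f : (Fin n → ℝ) → ℝ} {C : ℝ≥0} (hf : LipschitzWith C f) (i : Fin n)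
    (x : Fin n → ℝ) : ‖pderiv i f x‖ ≤ C := by
  refine (norm_lineDeriv_le_of_lipschitz ℝ hf).trans (mul_le_of_le_one_right C.2 ?_)
  rw [Pi.norm_single, norm_one]

lemma integrable_pderiv {f : (Fin n → ℝ) → ℝ} {C : ℝ≥0} (hf : LipschitzWith C f) (i : Fin n)
    (γ : Measure (Fin n → ℝ)) [IsFiniteMeasure γ] : Integrable (pderiv i f) γ :=
  integrable_of_forall_norm_le (measurable_lineDeriv hf.continuous) (norm_pderiv_le hf i)

variable (μ : Fin n → ℝ) {v : ℝ≥0}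

lemma memLp_id_pi_gaussianReal :
    MemLp (fun x : Fin n → ℝ => x) 2 (Measure.pi fun i => gaussianReal (μ i) v) :=
  MemLp.of_eval fun i =>
    (memLp_id_gaussianReal 2).comp_measurePreserving
      (measurePreserving_eval (fun i => gaussianReal (μ i) v) i)

/-- Stein's identity for Lipschitz functions of independent Gaussian variables. -/
lemma integral_mul_sub_pi_gaussianReal (hv : v ≠ 0) {f : (Fin n → ℝ) → ℝ} {C : ℝ≥0}
    (hf : LipschitzWith C f) (i : Fin n) :
    ∫ x, f x * (x i - μ i) ∂(Measure.pi fun i => gaussianReal (μ i) v)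
      = v * ∫ x, pderiv i f x ∂(Measure.pi fun i => gaussianReal (μ i) v) := by
  set γ := Measure.pi fun i => gaussianReal (μ i) v
  have hmp := measurePreserving_update_prod (fun i => gaussianReal (μ i) v) i
  have hid := memLp_id_pi_gaussianReal μ (v := v)
  have hi1 : Integrable (fun x => f x * (x i - μ i)) γ :=
    (hf.memLp_comp hid).integrable_mul ((hid.eval i).sub (memLp_const (μ i)))
  have hi2 : Integrable (pderiv i f) γ := integrable_pderiv hf i γ
  -- Integrating the resampled coordinate first reduces the claim to the one-variable identity on
  -- each slice.
  have hfub : ∀ {g : (Fin n → ℝ) → ℝ}, Integrable g γ →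
      ∫ x, g x ∂γ = ∫ x, ∫ t, g (Function.update x i t) ∂gaussianReal (μ i) v ∂γ := by
    intro g hg
    have h1 : Integrable (fun q : (Fin n → ℝ) × ℝ => g (Function.update q.1 i q.2))
        (γ.prod (gaussianReal (μ i) v)) := hmp.integrable_comp_of_integrable hg
    have h2 : AEStronglyMeasurable g ((γ.prod (gaussianReal (μ i) v)).map
        fun q : (Fin n → ℝ) × ℝ => Function.update q.1 i q.2) := by
      rw [hmp.map_eq]
      exact hg.aestronglyMeasurable
    rw [← integral_prod _ h1, ← integral_map hmp.aemeasurable h2, hmp.map_eq]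
  rw [hfub hi1, hfub hi2, ← integral_const_mul]
  congr 1
  ext x
  have hlip : LipschitzWith C fun t => f (Function.update x i t) := by
    have : LipschitzWith 1 fun t : ℝ => Function.update x i t := by
      refine LipschitzWith.of_dist_le_mul fun s t => ?_
      rw [NNReal.coe_one, one_mul]
      refine (dist_pi_le_iff dist_nonneg).2 fun j => ?_
      by_cases hj : j = i
      · subst hj; simp
      · simp [hj]
    have h := hf.comp this
    rwa [mul_one] at h
  simp only [Function.update_self, pderiv_update]
  exact integral_mul_sub_gaussianReal hlip (μ i) hv

lemma covariance_eq_integral_pderiv (hv : v ≠ 0) {f : (Fin n → ℝ) → ℝ} {C : ℝ≥0}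
    (hf : LipschitzWith C f) (i : Fin n) :
    cov[f, fun x => x i; Measure.pi fun i => gaussianReal (μ i) v]
      = v * ∫ x, pderiv i f x ∂(Measure.pi fun i => gaussianReal (μ i) v) := by
  set γ := Measure.pi fun i => gaussianReal (μ i) v
  have hid := memLp_id_pi_gaussianReal μ (v := v)
  have hEi : ∫ x : Fin n → ℝ, x i ∂γ = μ i := by
    have hmp := measurePreserving_eval (fun i => gaussianReal (μ i) v) i
    calc ∫ x : Fin n → ℝ, x i ∂γ = ∫ t, t ∂(γ.map (Function.eval i)) :=
          (integral_map hmp.aemeasurable aestronglyMeasurable_id).symm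
      _ = μ i := by rw [hmp.map_eq, integral_id_gaussianReal]
  have hfm : MemLp f 2 γ := hf.memLp_comp hid
  have hii : Integrable (fun x : Fin n → ℝ => x i) γ := (hid.eval i).integrable (by norm_num)
  rw [← integral_mul_sub_pi_gaussianReal μ hv hf i, covariance_eq_sub hfm (hid.eval i), hEi]
  have h1 : Integrable (fun x => f x * x i) γ := hfm.integrable_mul (hid.eval i)
  have h2 : Integrable (fun x => f x * μ i) γ := (hfm.integrable (by norm_num)).mul_const _
  simp only [mul_sub]
  rw [integral_sub h1 h2, integral_mul_const]
  rfl

end Stein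

/-! ### The divergence and trace of the lasso fit -/

section Fit

variable {n p : ℕ} {X : Matrix (Fin n) (Fin p) ℝ} {lam : ℝ} {betahat : (Fin n → ℝ) → Fin p → ℝ}

lemma lipschitzWith_lassoFit (hlam : 0 < lam)
    (hsol : ∀ w, IsLassoSolution X lam w (betahat w)) (i : Fin n) :
    LipschitzWith n fun z => (X *ᵥ betahat z) i := by
  refine LipschitzWith.of_dist_le_mul fun z z' => ?_
  rw [Real.dist_eq, dist_eq_norm, ← Pi.sub_apply, ← Matrix.mulVec_sub]
  refine (norm_le_pi_norm (X *ᵥ (betahat z - betahat z')) i).trans ?_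
  simpa using (hsol z).norm_fit_sub_le hlam (hsol z')

/-- By the product rule, differentiating `S` gives `δ`, while `∂w_j/∂w_i` keeps only the diagonal
entries `S_ii`. -/
lemma sum_pderiv_mulVec_self {S : (Fin n → ℝ) → Matrix (Fin n) (Fin n) ℝ} {z : Fin n → ℝ}
    (hS : ∀ k l, DifferentiableAt ℝ (fun w => S w k l) z) :
    ∑ i, pderiv i (fun w => (S w *ᵥ w) i) z = searchCorrection S z + (S z).trace := by
  rw [searchCorrection, Matrix.trace, ← Finset.sum_add_distrib]
  refine Finset.sum_congr rfl fun i _ => ?_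
  have hcoord : ∀ j, HasLineDerivAt ℝ (fun w : Fin n → ℝ => w j)
      ((Pi.single i 1 : Fin n → ℝ) j) z (Pi.single i 1) := fun j =>
    ((ContinuousLinearMap.proj (R := ℝ) (φ := fun _ : Fin n => ℝ) j).hasFDerivAt).hasLineDerivAt _
  have h : HasLineDerivAt ℝ (fun w => (S w *ᵥ w) i)
      (∑ j, (pderiv i (fun w => S w i j) z * z j + S z i j * (Pi.single i 1 : Fin n → ℝ) j))
      z (Pi.single i 1) := by
    simp only [Matrix.mulVec, dotProduct]
    unfold HasLineDerivAt
    refine HasDerivAt.fun_sum fun j _ => ?_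
    have h1 := (hS i j).hasLineDerivAt_pderiv i
    have h2 := hcoord j
    simpa using HasDerivAt.fun_mul h1 h2
  rw [pderiv, h.lineDeriv, Finset.sum_add_distrib]
  congr 1
  simp [Pi.single_apply]

lemma integrable_trace_lassoSmoother (hlam : 0 < lam) (hcont : Continuous betahat)
    (γ : Measure (Fin n → ℝ)) [IsFiniteMeasure γ] :
    Integrable (fun z => (lassoSmoother X lam betahat z).trace) γ := by
  refine integrable_of_forall_norm_le (C := n) ?_ fun z => ?_
  · refine Continuous.measurable (Continuous.matrix_trace ?_)
    exact (continuous_const.matrix_mul ((continuous_ridgeInv X hlam).comp hcont)).matrix_mul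
      continuous_const
  · refine (norm_sum_le _ _).trans ?_
    calc ∑ i, ‖(lassoSmoother X lam betahat z).diag i‖ ≤ ∑ _i : Fin n, (1 : ℝ) :=
          Finset.sum_le_sum fun i _ => abs_diag_smoother_le_one X hlam (betahat z) i
      _ = n := by simp

end Fit

theorem mainTheorem1 {Ω : Type*} [MeasurableSpace Ω] (P : Measure Ω) {n p : ℕ}
    (X : Matrix (Fin n) (Fin p) ℝ) (lam : ℝ) (hlam : 0 < lam)
    (μ : Fin n → ℝ) (σ : ℝ≥0) (hσ : 0 < σ)
    -- `y ∼ N(μ, σ² I)`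
    (y : Ω → Fin n → ℝ)
    (hy : HasLaw y (Measure.pi fun i => gaussianReal (μ i) (σ ^ 2)) P)
    -- `β̂(z)` is the unique lasso solution at `z`
    (betahat : (Fin n → ℝ) → Fin p → ℝ)
    (hbeta : ∀ (z : Fin n → ℝ) (b : Fin p → ℝ), IsLassoSolution X lam z b ↔ b = betahat z) :
    -- `(XᵀX + λΨ)⁻¹` is the limit of the ordinary inverses over nonzero coefficients
    (∀ b : Fin p → ℝ, Tendsto
      (fun θ : Fin p → ℝ =>
        (Xᵀ * X + lam • Matrix.diagonal fun j => 1 / (2 * |θ j|))⁻¹)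
      (𝓝[{θ : Fin p → ℝ | ∀ j, θ j ≠ 0}] b) (𝓝 (ridgeInv X lam b))) ∧
    -- `β̂ = (XᵀX + λΨ)⁻¹ Xᵀ y` and `ŷ = X β̂ = S(y) y`
    (∀ z : Fin n → ℝ, betahat z = (ridgeInv X lam (betahat z) * Xᵀ) *ᵥ z ∧
      X *ᵥ betahat z = lassoSmoother X lam betahat z *ᵥ z) ∧
    -- `β̂` is differentiable almost everywhere
    (∀ᵐ z ∂(volume : Measure (Fin n → ℝ)), DifferentiableAt ℝ betahat z) ∧
    -- wherever it is, so is `S`, and the formula for `∂S/∂y_i` holds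
    (∀ z : Fin n → ℝ, DifferentiableAt ℝ betahat z →
      (∀ k l, DifferentiableAt ℝ (fun w => lassoSmoother X lam betahat w k l) z) ∧
      ∀ i : Fin n,
        Matrix.of (fun k l => pderiv i (fun w => lassoSmoother X lam betahat w k l) z) =
          -(lam • (X * ridgeInv X lam (betahat z) * signMatrix (betahat z) *
            coefDerivMatrix betahat i z * ridgeInv X lam (betahat z) * Xᵀ))) ∧
    -- the covariances and expectations below exist
    (∀ i, MemLp (fun ω => (X *ᵥ betahat (y ω)) i) 2 P) ∧
    Integrable (fun ω => searchCorrection (lassoSmoother X lam betahat) (y ω)) P ∧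
    Integrable (fun ω => (lassoSmoother X lam betahat (y ω)).trace) P ∧
    -- `df = E[δ + tr S(y)]`
    degreesOfFreedom P y σ (fun z => X *ᵥ betahat z) =
      ∫ ω, (searchCorrection (lassoSmoother X lam betahat) (y ω)
        + (lassoSmoother X lam betahat (y ω)).trace) ∂P ∧
    -- `msdf = E[δ]`
    modifiedSearchDF P y σ (lassoSmoother X lam betahat) =
      ∫ ω, searchCorrection (lassoSmoother X lam betahat) (y ω) ∂P := by
  have hsol : ∀ w, IsLassoSolution X lam w (betahat w) := fun w => (hbeta w _).2 rfl
  have hcont := continuous_lassoSolution hlam hbeta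
  obtain ⟨C, hC⟩ := exists_lipschitzWith_lassoSolution hlam hbeta
  have hridge : ∀ z, betahat z = (ridgeInv X lam (betahat z) * Xᵀ) *ᵥ z := fun z =>
    (hsol z).eq_ridgeInv_mulVec hlam
  have hfit : ∀ z, X *ᵥ betahat z = lassoSmoother X lam betahat z *ᵥ z := by
    intro z
    conv_lhs => rw [hridge z]
    rw [Matrix.mulVec_mulVec, lassoSmoother, Matrix.mul_assoc]
  have hdiff : ∀ᵐ z ∂(volume : Measure (Fin n → ℝ)), DifferentiableAt ℝ betahat z :=
    hC.ae_differentiableAt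
  have hS : ∀ z, DifferentiableAt ℝ betahat z → ∀ k l,
      DifferentiableAt ℝ (fun w => lassoSmoother X lam betahat w k l) z := fun z hz =>
    differentiableAt_lassoSmoother hlam hcont hsol hz
  have hv : σ ^ 2 ≠ 0 := pow_ne_zero 2 hσ.ne'
  set γ := Measure.pi fun i => gaussianReal (μ i) (σ ^ 2) with hγ
  -- Nonzero variance lets Lebesgue-a.e. differentiability pass to the law of `y`.
  have hac : γ ≪ (volume : Measure (Fin n → ℝ)) :=
    absolutelyContinuous_pi _ _ fun i => gaussianReal_absolutelyContinuous _ hv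
  have hlip := lipschitzWith_lassoFit hlam hsol
  have hsum : (fun z => ∑ i, pderiv i (fun w => (X *ᵥ betahat w) i) z) =ᵐ[γ] fun z =>
      searchCorrection (lassoSmoother X lam betahat) z
        + (lassoSmoother X lam betahat z).trace := by
    filter_upwards [hac.ae_le hdiff] with z hz
    simp only [hfit]
    exact sum_pderiv_mulVec_self (hS z hz)
  have hpd : ∀ i, Integrable (pderiv i fun w => (X *ᵥ betahat w) i) γ := fun i =>
    integrable_pderiv (hlip i) i γ
  have htr : Integrable (fun z => (lassoSmoother X lam betahat z).trace) γ :=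
    integrable_trace_lassoSmoother hlam hcont γ
  have hδ : Integrable (searchCorrection (lassoSmoother X lam betahat)) γ := by
    -- No direct bound on `∂S` is needed: `δ` agrees a.e. with the divergence minus the trace.
    refine ((integrable_finsetSum Finset.univ fun i _ => hpd i).sub htr).congr ?_
    filter_upwards [hsum] with z hz
    simp only [Pi.sub_apply]
    rw [hz, add_sub_cancel_right]
  have htrP : Integrable (fun ω => (lassoSmoother X lam betahat (y ω)).trace) P := by
    rw [← hy.map_eq] at htr
    exact htr.comp_aemeasurable hy.aemeasurable
  have hδP : Integrable (fun ω => searchCorrection (lassoSmoother X lam betahat) (y ω)) P := by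
    rw [← hy.map_eq] at hδ
    exact hδ.comp_aemeasurable hy.aemeasurable
  have hdf : degreesOfFreedom P y σ (fun z => X *ᵥ betahat z) =
      ∫ ω, (searchCorrection (lassoSmoother X lam betahat) (y ω)
        + (lassoSmoother X lam betahat (y ω)).trace) ∂P := by
    have hcov : ∀ i, cov[fun ω => (X *ᵥ betahat (y ω)) i, fun ω => y ω i; P]
        = (σ : ℝ) ^ 2 * ∫ z, pderiv i (fun w => (X *ᵥ betahat w) i) z ∂γ := by
      intro i
      have h1 := hy.covariance_fun_comp (f := fun z => (X *ᵥ betahat z) i) (g := fun z => z i)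
        (hlip i).continuous.aemeasurable (measurable_pi_apply i).aemeasurable
      have h2 := covariance_eq_integral_pderiv μ hv (hlip i) i
      rw [h1]
      simpa using h2
    have h3 := hy.integral_comp (f := fun z => searchCorrection (lassoSmoother X lam betahat) z
        + (lassoSmoother X lam betahat z).trace) (hδ.add htr).aestronglyMeasurable
    have hσ' : (σ : ℝ) ≠ 0 := NNReal.coe_ne_zero.2 hσ.ne'
    refine Eq.trans ?_ h3.symm
    rw [degreesOfFreedom, ← integral_congr_ae hsum, integral_finsetSum _ fun i _ => hpd i]
    simp only [hcov]
    rw [← Finset.mul_sum, ← mul_assoc, one_div, inv_mul_cancel₀ (pow_ne_zero 2 hσ'), one_mul]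
  refine ⟨tendsto_inv_ridge X hlam, fun z => ⟨hridge z, hfit z⟩, hdiff,
    fun z hz => ⟨hS z hz, matrixPDeriv_lassoSmoother hlam hcont hsol hz⟩, fun i => ?_, hδP, htrP,
    hdf, ?_⟩
  · have h1 : MemLp (fun z => (X *ᵥ betahat z) i) 2 γ :=
      (hlip i).memLp_comp (memLp_id_pi_gaussianReal μ)
    rw [← hy.map_eq] at h1
    exact h1.comp_of_map hy.aemeasurable
  · have hfun : (fun z => lassoSmoother X lam betahat z *ᵥ z) = fun z => X *ᵥ betahat z :=
      funext fun z => (hfit z).symm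
    rw [modifiedSearchDF, hfun, hdf, integral_add hδP htrP, add_sub_cancel_right]
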